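/- Let $F$ be a free group of finite rank at least $2$. A \emph{subgroup system} is a nonempty finite collection of subgroups of $F$, called its components. A \emph{free factor system} is either the trivial system $\{1\}$, whose only component is the trivial subgroup, or a nonempty finite collection $\{A_1,\dots,A_l\}$ of nontrivial subgroups such that $\langle A_1,\dots,A_l\rangle$ is the free product $A_1*\cdots*A_l$ and is a free factor of $F$. A system $\mathcal A$ \emph{carries} a system $\mathcal B$ if every $B\in\mathcal B$ satisfies $B\le xAx^{-1}$ for some $A\in\mathcal A$ and $x\in F$; for free factor systems one writes $\mathcal B\preceq\mathcal A$. This is a preorder, and free factor systems are called equivalent if each carries the other. For an endomorphism $\phi$ of $F$ put $\phi(\mathcal A)=\{\phi(A):A\in\mathcal A\}$. The system $\mathcal A$ is \emph{$[\phi]$-invariant} if $\mathcal A$ carries $\phi(\mathcal A)$, and \emph{$[\phi]$-fixed} if there is a permutation $\sigma$ of its components such that $\phi(A)$ is conjugate to $\sigma(A)$ for every $A\in\mathcal A$. Let $\phi:F\to F$ be an injective endomorphism and let $\mathcal A$ be a $\preceq$-maximal $[\phi]$-fixed free factor system. Then among the $[\phi]$-invariant free factor systems $\mathcal B\succeq\mathcal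 A$ such that $\phi^k(\mathcal B)$ is carried by $\mathcal A$ for some $k\ge 0$ there is a maximal one $\mathcal A^*$ with respect to $\preceq$; it carries all the others, and it is the unique maximal one up to equivalence (the $[\phi]$-elliptic free factor system). Moreover, for every such maximal $\mathcal A^*$, one can replace each component of $\mathcal A$ with a conjugate so that the result is again a free factor system and $\mathcal A\subset\mathcal A^*$. -/

import Mathlib

namespace FreeFactor

variable {F : Type*} [Group F]

/-- The conjugate `x A x⁻¹` of a subgroup. -/
def conjBy (x : F) (A : Subgroup F) : Subgroup F :=
  A.map (MulAut.conj x).toMonoidHom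

/-- `A` is a free factor of `F`: `F` is the internal free product of `A` and some subgroup `B`. -/
def IsFreeFactor (A : Subgroup F) : Prop :=
  ∃ B : Subgroup F, Function.Bijective (Monoid.Coprod.lift A.subtype B.subtype)

/-- A nontrivial free factor system: a nonempty finite collection of nontrivial subgroups which
generate their free product, this free product being a free factor of `F`. Each component is
then itself a free factor, and distinct components intersect trivially. -/
structure IsNontrivialFreeFactorSystem (𝒜 : Set (Subgroup F)) : Prop where
  finite : 𝒜.Finite
  nonempty : 𝒜.Nonempty
  ne_bot : ∀ A ∈ 𝒜, A ≠ ⊥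
  freeProduct : Function.Injective (Monoid.CoprodI.lift fun A : 𝒜 => (A : Subgroup F).subtype)
  freeFactor : IsFreeFactor (sSup 𝒜)

/-- A free factor system is the trivial system, whose only component is the trivial subgroup,
or a nontrivial free factor system. -/
def IsFreeFactorSystem (𝒜 : Set (Subgroup F)) : Prop :=
  𝒜 = {⊥} ∨ IsNontrivialFreeFactorSystem 𝒜

/-- `𝒜` carries `ℬ`: each component of `ℬ` lies in a conjugate of a component of `𝒜`.
For free factor systems this is the relation `ℬ ⪯ 𝒜`. -/
def Carries (𝒜 ℬ : Set (Subgroup F)) : Prop :=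
  ∀ B ∈ ℬ, ∃ A ∈ 𝒜, ∃ x : F, B ≤ conjBy x A

/-- Equivalence of systems for the preorder `⪯`. -/
def SystemEquiv (𝒜 ℬ : Set (Subgroup F)) : Prop :=
  Carries 𝒜 ℬ ∧ Carries ℬ 𝒜

/-- The system `φ(𝒜) = {φ(A) : A ∈ 𝒜}`; its iterates are the systems `φ^k(𝒜)`. -/
def mapSystem (φ : F →* F) (𝒜 : Set (Subgroup F)) : Set (Subgroup F) :=
  Subgroup.map φ '' 𝒜

/-- `𝒜` is `[φ]`-invariant. -/
def IsInvariant (φ : F →* F) (𝒜 : Set (Subgroup F)) : Prop :=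
  Carries 𝒜 (mapSystem φ 𝒜)

/-- `𝒜` is `[φ]`-fixed: `φ` permutes the components of `𝒜` up to conjugacy. -/
def IsFixed (φ : F →* F) (𝒜 : Set (Subgroup F)) : Prop :=
  ∃ σ : Equiv.Perm 𝒜, ∀ A : 𝒜, ∃ x : F,
    (A : Subgroup F).map φ = conjBy x (σ A : Subgroup F)

/-- `𝒜` is a maximal `[φ]`-fixed free factor system, with respect to `⪯`. -/
structure IsMaximalFixed (φ : F →* F) (𝒜 : Set (Subgroup F)) : Prop where
  system : IsFreeFactorSystem 𝒜
  fixed : IsFixed φ 𝒜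
  maximal : ∀ ℬ : Set (Subgroup F), IsFreeFactorSystem ℬ → IsFixed φ ℬ →
    Carries ℬ 𝒜 → Carries 𝒜 ℬ

/-- `ℬ` is a `[φ]`-invariant free factor system with `𝒜 ⪯ ℬ` such that `φ^k(ℬ)` is carried by
`𝒜` for some `k ≥ 0`. -/
structure IsEventuallyCarried (φ : F →* F) (𝒜 ℬ : Set (Subgroup F)) : Prop where
  system : IsFreeFactorSystem ℬ
  invariant : IsInvariant φ ℬ
  carries : Carries ℬ 𝒜
  eventually : ∃ k : ℕ, Carries 𝒜 ((mapSystem φ)^[k] ℬ)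

/-- `ℰ` is maximal, with respect to `⪯`, among the `[φ]`-invariant free factor systems `ℬ ⪰ 𝒜`
such that `φ^k(ℬ)` is carried by `𝒜` for some `k ≥ 0`. -/
structure IsElliptic (φ : F →* F) (𝒜 ℰ : Set (Subgroup F)) : Prop where
  eventuallyCarried : IsEventuallyCarried φ 𝒜 ℰ
  maximal : ∀ ℬ : Set (Subgroup F), IsEventuallyCarried φ 𝒜 ℬ → Carries ℬ ℰ → Carries ℰ ℬ

/-- `𝒜'` is obtained from `𝒜` by replacing each component with a conjugate. -/
def IsConjugateReplacement (𝒜 𝒜' : Set (Subgroup F)) : Prop :=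
  ∃ e : 𝒜 ≃ 𝒜', ∀ A : 𝒜, ∃ x : F, (e A : Subgroup F) = conjBy x (A : Subgroup F)

end FreeFactor

open FreeFactor

/-!
Fix an injective `φ` and a nontrivial `[φ]`-fixed system `𝒜`. By the Kurosh subgroup theorem the
nontrivial preimages under `φ ^ k` of the conjugates of the components of `𝒜` form, up to
conjugacy, a free factor system `𝒮 k`, and `𝒮 k` carries `ℬ` if and only if `𝒜` carries
`φ ^ k (ℬ)`. Invariance of `𝒜` makes the sequence `𝒮 k` ascending, so it is eventually constant up
to equivalence: along a strictly ascending chain of free factor systems, either fewer homomorphisms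
to `ℤ/2` kill all components, or the same number do and there are fewer components. The stable
value is `[φ]`-invariant and carries every invariant system which some iterate of `φ` moves into
`𝒜`.

If `A ∈ 𝒜` lies in a conjugate `E'` of a component of such a system `ℰ ⪰ 𝒜`, then `φ ^ k (E')` is
sandwiched between `φ ^ k (A)`, which is conjugate to a component of `𝒜`, and a conjugate of a
component of `𝒜`. A nontrivial free factor in a free factor family has no conjugate properly
contained in a conjugate of a member of the family, so `A = E'` by injectivity.

The Kurosh theorem comes from extending cocycles. If `F` is the free product of the `S i` and acts
on a set, then arbitrary cocycles of the `S i` extend to a unique cocycle of `F`, which restricts to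
a homomorphism on the stabilizer of a point. Suitable cocycles yield a homomorphism with prescribed
values on the conjugates of the `S i` in the stabilizer, that is, the universal property of a free
product.
-/

namespace FreeFactor

section Conjugates

open scoped Pointwise

variable {G H : Type*} [Group G] [Group H]

theorem conjBy_eq_smul (x : G) (A : Subgroup G) : conjBy x A = MulAut.conj x • A :=
  rfl

theorem mem_conjBy {x g : G} {A : Subgroup G} : g ∈ conjBy x A ↔ x⁻¹ * g * x ∈ A := by
  rw [conjBy_eq_smul, Subgroup.mem_pointwise_smul_iff_inv_smul_mem, ← map_inv, MulAut.smul_def,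
    MulAut.conj_apply, inv_inv]

theorem conjBy_conjBy (x y : G) (A : Subgroup G) : conjBy x (conjBy y A) = conjBy (x * y) A := by
  simp only [conjBy_eq_smul, smul_smul, map_mul]

@[simp]
theorem conjBy_one (A : Subgroup G) : conjBy 1 A = A := by
  rw [conjBy_eq_smul, map_one, one_smul]

@[simp]
theorem conjBy_inv_conjBy (x : G) (A : Subgroup G) : conjBy x⁻¹ (conjBy x A) = A := by
  rw [conjBy_conjBy, inv_mul_cancel, conjBy_one]

@[simp]
theorem conjBy_conjBy_inv (x : G) (A : Subgroup G) : conjBy x (conjBy x⁻¹ A) = A := by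
  rw [conjBy_conjBy, mul_inv_cancel, conjBy_one]

@[simp]
theorem conjBy_bot (x : G) : conjBy x (⊥ : Subgroup G) = ⊥ :=
  Subgroup.map_bot _

theorem conjBy_mono (x : G) {A B : Subgroup G} (h : A ≤ B) : conjBy x A ≤ conjBy x B :=
  Subgroup.map_mono h

theorem conjBy_le_iff {x : G} {A B : Subgroup G} : conjBy x A ≤ B ↔ A ≤ conjBy x⁻¹ B :=
  ⟨fun h => by simpa using conjBy_mono x⁻¹ h, fun h => by simpa using conjBy_mono x h⟩

@[simp]
theorem conjBy_eq_bot_iff {x : G} {A : Subgroup G} : conjBy x A = ⊥ ↔ A = ⊥ :=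
  Subgroup.map_eq_bot_iff_of_injective _ (MulAut.conj x).injective

theorem conjBy_of_mem {x : G} {A : Subgroup G} (hx : x ∈ A) : conjBy x A = A :=
  Subgroup.conj_smul_eq_self_of_mem hx

theorem conjBy_of_normal (x : G) (N : Subgroup G) [N.Normal] : conjBy x N = N :=
  Subgroup.Normal.conj_smul_eq_self x N

theorem map_conjBy (f : G →* H) (x : G) (A : Subgroup G) :
    (conjBy x A).map f = conjBy (f x) (A.map f) := by
  simp only [conjBy, Subgroup.map_map]
  congr 1
  ext g
  simp

theorem conjBy_comap (f : G →* H) (x : G) (A : Subgroup H) :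
    conjBy x (A.comap f) = (conjBy (f x) A).comap f := by
  ext g
  simp [mem_conjBy]

theorem conjBy_eq_of_retraction {A : Subgroup G} (r : G →* A) (hr : ∀ a : A, r a = a) {x : G}
    (h : A ≤ conjBy x A) : conjBy x A = A := by
  refine le_antisymm (fun g hg => ?_) h
  have eq_one : ∀ y ∈ conjBy x A, r y = 1 → y = 1 := by
    intro y hy hry
    have := hr ⟨_, mem_conjBy.1 hy⟩
    simp only [map_mul, hry, mul_one, map_inv, inv_mul_cancel] at this
    simpa [mul_eq_one_iff_eq_inv] using congrArg Subtype.val this.symm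
  have : g * (r g : G)⁻¹ = 1 :=
    eq_one _ (mul_mem hg (inv_mem (h (r g).2))) (by simp [hr])
  rw [mul_inv_eq_one.1 this]
  exact (r g).2

end Conjugates

section FreeProduct

open Monoid

variable {G K : Type*} [Group G] [Group K] {ι : Type*} {S : ι → Subgroup G}

/-- `G` is the internal free product of the subgroups `S i`. -/
def IsFreeProduct (S : ι → Subgroup G) : Prop :=
  Function.Bijective (CoprodI.lift fun i => (S i).subtype)

/-- The inclusion of a subgroup of a family into the external free product of the family. -/
abbrev inclCoprodI (S : ι → Subgroup G) (i : ι) : S i →* CoprodI fun i => S i :=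
  CoprodI.of (M := fun i => S i) (i := i)

theorem range_lift_subtype (S : ι → Subgroup G) :
    (CoprodI.lift fun i => (S i).subtype).range = ⨆ i, S i := by
  simp [CoprodI.range_eq_iSup]

theorem IsFreeProduct.iSup_eq_top (h : IsFreeProduct S) : ⨆ i, S i = ⊤ := by
  rw [← range_lift_subtype, MonoidHom.range_eq_top.2 h.2]

theorem IsFreeProduct.exists_hom (h : IsFreeProduct S) (χ : ∀ i, S i →* K) :
    ∃ f : G →* K, ∀ i (s : S i), f s = χ i s := by
  let e := MulEquiv.ofBijective _ h
  refine ⟨(CoprodI.lift χ).comp e.symm, fun i s => ?_⟩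
  have : e.symm s = inclCoprodI S i s :=
    e.symm_apply_eq.2 (CoprodI.lift_of (fun i => (S i).subtype) s).symm
  simp [this]

theorem isFreeProduct_of_hom (hS : ⨆ i, S i = ⊤) (f : G →* CoprodI fun i => S i)
    (hf : ∀ i (s : S i), f s = inclCoprodI S i s) : IsFreeProduct S := by
  have hid : f.comp (CoprodI.lift fun i => (S i).subtype) = MonoidHom.id _ :=
    CoprodI.ext_hom _ _ fun i => by ext s; simp [hf]
  refine ⟨Function.LeftInverse.injective (g := f) (DFunLike.congr_fun hid), ?_⟩
  rw [← MonoidHom.range_eq_top, range_lift_subtype, hS]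

theorem hom_eq_on_iSup {f : G →* K} {g : (⨆ i, S i : Subgroup G) →* K}
    (h : ∀ i (s : S i), f s = g (Subgroup.inclusion (le_iSup S i) s))
    (x : (⨆ i, S i : Subgroup G)) : f x = g x := by
  obtain ⟨x, hx⟩ := x
  induction hx using Subgroup.iSup_induction' with
  | hp i x hx => exact h i ⟨x, hx⟩
  | h1 => exact (map_one f).trans (map_one g).symm
  | hmul x y hx hy ihx ihy => exact (map_mul f x y).trans (by rw [ihx, ihy, ← map_mul]; rfl)

theorem hom_ext_of_iSup_eq_top (hS : ⨆ i, S i = ⊤) {f g : G →* K}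
    (h : ∀ i, ∀ s ∈ S i, f s = g s) : f = g :=
  MonoidHom.eq_of_eqOn_top fun x _ =>
    hom_eq_on_iSup (g := g.comp (Subgroup.subtype _)) (fun i s => h i s s.2)
      ⟨x, hS ▸ Subgroup.mem_top x⟩

theorem IsFreeProduct.regroup (h : IsFreeProduct S) {κ : Type*} (π : ι → κ) :
    IsFreeProduct fun k => ⨆ i : {i // π i = k}, S i := by
  set T : κ → Subgroup G := fun k => ⨆ i : {i // π i = k}, S i
  have hle (i : ι) : S i ≤ T (π i) := le_iSup (fun j : {j // π j = π i} => S j) ⟨i, rfl⟩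
  obtain ⟨f, hf⟩ := h.exists_hom fun i => (inclCoprodI T (π i)).comp (Subgroup.inclusion (hle i))
  refine isFreeProduct_of_hom ?_ f fun k => hom_eq_on_iSup ?_
  · exact eq_top_mono (iSup_le fun i => (hle i).trans (le_iSup T (π i))) h.iSup_eq_top
  · rintro ⟨i, rfl⟩ s
    exact hf i s

theorem IsFreeProduct.map (h : IsFreeProduct S) (e : G ≃* K) :
    IsFreeProduct fun i => (S i).map e.toMonoidHom := by
  obtain ⟨f, hf⟩ := h.exists_hom fun i =>
    (inclCoprodI (fun i => (S i).map e.toMonoidHom) i).comp (e.subgroupMap (S i)).toMonoidHom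
  refine isFreeProduct_of_hom ?_ (f.comp e.symm.toMonoidHom) ?_
  · rw [← Subgroup.map_iSup, h.iSup_eq_top, Subgroup.map_top_of_surjective _ e.surjective]
  · rintro i ⟨_, s, hs, rfl⟩
    exact (congrArg f (e.symm_apply_apply s)).trans (hf i ⟨s, hs⟩)

/-- The subgroups `S i` form a free factor family: together with some further subgroup, `G` is
their internal free product. -/
def IsFreeFactorFamily (S : ι → Subgroup G) : Prop :=
  ∃ B : Subgroup G, IsFreeProduct fun o : Option ι => o.elim B S

theorem IsFreeFactorFamily.map (h : IsFreeFactorFamily S) (e : G ≃* K) :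
    IsFreeFactorFamily fun i => (S i).map e.toMonoidHom := by
  obtain ⟨B, hB⟩ := h
  refine ⟨B.map e.toMonoidHom, ?_⟩
  convert hB.map e using 2 with o
  cases o <;> rfl

theorem IsFreeFactorFamily.exists_hom (h : IsFreeFactorFamily S) (χ : ∀ i, S i →* K) :
    ∃ f : G →* K, ∀ i (s : S i), f s = χ i s := by
  obtain ⟨B, hB⟩ := h
  obtain ⟨f, hf⟩ := hB.exists_hom fun
    | none => 1
    | some i => χ i
  exact ⟨f, fun i => hf (some i)⟩

theorem IsFreeFactorFamily.injective_lift (h : IsFreeFactorFamily S) :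
    Function.Injective (CoprodI.lift fun i => (S i).subtype) := by
  obtain ⟨f, hf⟩ := h.exists_hom (inclCoprodI S)
  have hid : f.comp (CoprodI.lift fun i => (S i).subtype) = MonoidHom.id _ :=
    CoprodI.ext_hom _ _ fun i => by ext s; simp [hf]
  exact Function.LeftInverse.injective (g := f) (DFunLike.congr_fun hid)

theorem IsFreeFactorFamily.isFreeFactor_iSup (h : IsFreeFactorFamily S) :
    IsFreeFactor (⨆ i, S i) := by
  obtain ⟨B, hB⟩ := h
  obtain ⟨f, hf⟩ := hB.exists_hom (K := Coprod (⨆ i, S i : Subgroup G) B) fun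
    | none => Coprod.inr
    | some i => Coprod.inl.comp (Subgroup.inclusion (le_iSup S i))
  have hf_iSup := hom_eq_on_iSup (f := f) (g := Coprod.inl) fun i => hf (some i)
  have hid : f.comp (Coprod.lift (⨆ i, S i).subtype B.subtype) = MonoidHom.id _ := by
    refine Coprod.hom_ext ?_ ?_
    · ext x; simp [hf_iSup]
    · ext x; simpa using! hf none x
  refine ⟨B, Function.LeftInverse.injective (g := f) (DFunLike.congr_fun hid), ?_⟩
  rw [← MonoidHom.range_eq_top, Coprod.range_lift, Subgroup.range_subtype,
    Subgroup.range_subtype, ← hB.iSup_eq_top, iSup_option, sup_comm]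
  rfl

theorem exists_hom_iSup_of_injective_lift
    (hS : Function.Injective (CoprodI.lift fun i => (S i).subtype)) (χ : ∀ i, S i →* K) :
    ∃ f : (⨆ i, S i : Subgroup G) →* K,
      ∀ i (s : S i), f (Subgroup.inclusion (le_iSup S i) s) = χ i s := by
  let e := (MonoidHom.ofInjective hS).trans (MulEquiv.subgroupCongr (range_lift_subtype S))
  refine ⟨(CoprodI.lift χ).comp e.symm.toMonoidHom, fun i s => ?_⟩
  have : e.symm (Subgroup.inclusion (le_iSup S i) s) = inclCoprodI S i s :=
    e.symm_apply_eq.2 (Subtype.ext (CoprodI.lift_of (fun i => (S i).subtype) s).symm)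
  simp [this]

theorem exists_hom_of_bijective_coprodLift {A B : Subgroup G}
    (h : Function.Bijective (Coprod.lift A.subtype B.subtype)) (f : A →* K) (g : B →* K) :
    ∃ k : G →* K, (∀ a : A, k a = f a) ∧ ∀ b : B, k b = g b := by
  let e := MulEquiv.ofBijective _ h
  refine ⟨(Coprod.lift f g).comp e.symm.toMonoidHom, fun a => ?_, fun b => ?_⟩
  · have : e.symm a = Coprod.inl a :=
      e.symm_apply_eq.2 (Coprod.lift_apply_inl A.subtype B.subtype a).symm
    simp [this]
  · have : e.symm b = Coprod.inr b :=
      e.symm_apply_eq.2 (Coprod.lift_apply_inr A.subtype B.subtype b).symm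
    simp [this]

theorem isFreeFactorFamily_of_isFreeFactor_iSup
    (hS : Function.Injective (CoprodI.lift fun i => (S i).subtype))
    (hfactor : IsFreeFactor (⨆ i, S i)) : IsFreeFactorFamily S := by
  obtain ⟨B, hB⟩ := hfactor
  let T : Option ι → Subgroup G := fun o => o.elim B S
  obtain ⟨f, hf⟩ := exists_hom_iSup_of_injective_lift hS fun i => inclCoprodI T (some i)
  obtain ⟨k, hk_iSup, hk_B⟩ := exists_hom_of_bijective_coprodLift hB f (inclCoprodI T none)
  refine ⟨B, isFreeProduct_of_hom ?_ k ?_⟩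
  · rw [iSup_option, sup_comm, ← MonoidHom.range_eq_top.2 hB.2, Coprod.range_lift,
      Subgroup.range_subtype, Subgroup.range_subtype]
    rfl
  · rintro (_ | i) s
    · exact hk_B s
    · exact (hk_iSup (Subgroup.inclusion (le_iSup S i) s)).trans (hf i s)

theorem IsFreeFactorFamily.exists_extension (h : IsFreeFactorFamily S) (i : ι) (χ : S i →* K) :
    ∃ f : G →* K, (∀ s : S i, f s = χ s) ∧ ∀ j ≠ i, S j ≤ f.ker := by
  classical
  obtain ⟨f, hf⟩ := h.exists_hom (Pi.mulSingle i χ)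
  refine ⟨f, fun s => by rw [hf i, Pi.mulSingle_eq_same], fun j hj s hs => ?_⟩
  rw [MonoidHom.mem_ker, hf j ⟨s, hs⟩, Pi.mulSingle_eq_of_ne hj, MonoidHom.one_apply]

theorem IsFreeFactorFamily.comp_injective (h : IsFreeFactorFamily S) {κ : Type*} {f : κ → ι}
    (hf : Function.Injective f) : IsFreeFactorFamily (S ∘ f) := by
  obtain ⟨B, hB⟩ := h
  let π : Option ι → Option κ := fun o => o.bind (Function.partialInv f)
  have hπ (o : Option ι) (k : κ) : π o = some k ↔ o = some (f k) := by
    cases o with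
    | none => simp [π]
    | some i => simp [π, hf.isPartialInv k i, eq_comm]
  refine ⟨⨆ o : {o // π o = none}, o.1.elim B S, ?_⟩
  convert hB.regroup π using 2 with o
  cases o with
  | none => rfl
  | some k => simp [hπ, iSup_subtype]

theorem IsFreeFactorFamily.coe_of_subset_range (h : IsFreeFactorFamily S) {𝒮 : Set (Subgroup G)}
    (h𝒮 : 𝒮 ⊆ Set.range S) : IsFreeFactorFamily fun P : 𝒮 => (P : Subgroup G) := by
  choose f hf using fun P : 𝒮 => h𝒮 P.2
  rw [← show S ∘ f = fun P : 𝒮 => (P : Subgroup G) from funext hf]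
  exact h.comp_injective fun P Q hPQ => Subtype.ext (by rw [← hf P, ← hf Q, hPQ])

theorem IsFreeFactorFamily.eq_of_le_conjBy (h : IsFreeFactorFamily S) {i j : ι} (hi : S i ≠ ⊥)
    {x : G} (hle : S i ≤ conjBy x (S j)) : i = j ∧ conjBy x (S j) = S i := by
  obtain ⟨r, hr, hr_ker⟩ := h.exists_extension i (MonoidHom.id _)
  obtain rfl : i = j := by
    by_contra hij
    refine hi ((Subgroup.eq_bot_iff_forall _).2 fun s hs => ?_)
    have : s ∈ r.ker := conjBy_of_normal x r.ker ▸ conjBy_mono x (hr_ker j (Ne.symm hij)) (hle hs)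
    simpa [hr ⟨s, hs⟩] using this
  exact ⟨rfl, conjBy_eq_of_retraction r hr hle⟩

theorem IsFreeFactorFamily.eq_of_conjBy_le_conjBy (h : IsFreeFactorFamily S) {i j : ι}
    (hi : S i ≠ ⊥) {x y : G} (hle : conjBy x (S i) ≤ conjBy y (S j)) :
    i = j ∧ conjBy x (S i) = conjBy y (S j) := by
  rw [conjBy_le_iff, conjBy_conjBy] at hle
  obtain ⟨hij, heq⟩ := h.eq_of_le_conjBy hi hle
  exact ⟨hij, by rw [← heq, conjBy_conjBy, mul_inv_cancel_left]⟩

theorem isNontrivialFreeFactorSystem_iff {𝒜 : Set (Subgroup G)} :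
    IsNontrivialFreeFactorSystem 𝒜 ↔ 𝒜.Finite ∧ 𝒜.Nonempty ∧ (∀ A ∈ 𝒜, A ≠ ⊥) ∧
      IsFreeFactorFamily fun A : 𝒜 => (A : Subgroup G) := by
  constructor
  · intro h
    exact ⟨h.finite, h.nonempty, h.ne_bot, isFreeFactorFamily_of_isFreeFactor_iSup h.freeProduct
      (sSup_eq_iSup' 𝒜 ▸ h.freeFactor)⟩
  · rintro ⟨hfin, hne, hbot, h⟩
    exact ⟨hfin, hne, hbot, h.injective_lift, sSup_eq_iSup' 𝒜 ▸ h.isFreeFactor_iSup⟩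

end FreeProduct

section Cocycles

variable {M X K : Type*} [Group M] [MulAction M X] [Group K]

/-- Cocycles of a group acting on `X`, with values in `K`: functors from the action groupoid
to `K`, the value `c g x` being attached to the arrow from `x` to `g • x`. -/
def IsCocycle (c : M → X → K) : Prop :=
  ∀ g h x, c (g * h) x = c g (h • x) * c h x

theorem IsCocycle.map_one {c : M → X → K} (hc : IsCocycle c) (x : X) : c 1 x = 1 := by
  simpa using hc 1 1 x

theorem IsCocycle.map_inv_mul {c : M → X → K} (hc : IsCocycle c) {g h : M} {x : X}
    (hgh : g • x = h • x) : c (g⁻¹ * h) x = (c g x)⁻¹ * c h x := by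
  have := hc g (g⁻¹ * h) x
  rw [mul_inv_cancel_left, mul_smul, ← hgh, inv_smul_smul] at this
  rw [this, inv_mul_cancel_left]

/-- A cocycle restricts to a homomorphism on each stabilizer. -/
def IsCocycle.stabilizerHom {c : M → X → K} (hc : IsCocycle c) (x : X) :
    MulAction.stabilizer M x →* K :=
  MonoidHom.mk' (fun g => c g x) fun g h => by
    rw [Subgroup.coe_mul, hc, MulAction.mem_stabilizer_iff.1 h.2]

/-- The homomorphism to the unrestricted wreath product of `K` by `M` given by a cocycle of a
subgroup `N` of `M`. It is a section of the projection to `M` over `N`. -/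
def IsCocycle.toWreath {N : Subgroup M} {c : N → X → K} (hc : IsCocycle c) :
    N →* (X → K) ⋊[mulAutArrow] M :=
  MonoidHom.mk' (fun g => ⟨fun x => c g (g⁻¹ • x), g⟩) fun g h => by
    refine SemidirectProduct.ext (funext fun x => ?_) rfl
    simp only [SemidirectProduct.mul_left, Pi.mul_apply, mul_inv_rev, hc g h, mul_smul,
      smul_inv_smul]
    rfl

theorem IsFreeProduct.exists_cocycle {ι : Type*} {S : ι → Subgroup M} (h : IsFreeProduct S)
    {C : ∀ i, S i → X → K} (hC : ∀ i, IsCocycle (C i)) :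
    ∃ c : M → X → K, IsCocycle c ∧ ∀ i (s : S i), c s = C i s := by
  obtain ⟨Ψ, hΨ⟩ := h.exists_hom fun i => (hC i).toWreath
  have hΨ_right (g : M) : (Ψ g).right = g := by
    refine DFunLike.congr_fun (f := SemidirectProduct.rightHom.comp Ψ) (g := MonoidHom.id M)
      (hom_ext_of_iSup_eq_top h.iSup_eq_top fun i s hs => ?_) g
    exact congrArg SemidirectProduct.right (hΨ i ⟨s, hs⟩)
  refine ⟨fun g x => (Ψ g).left (g • x), fun g k x => ?_, fun i s => funext fun x => ?_⟩
  · simp only [map_mul, SemidirectProduct.mul_left, hΨ_right, Pi.mul_apply, mul_smul]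
    exact congrArg (fun y => (Ψ g).left (g • k • x) * (Ψ k).left y) (inv_smul_smul g (k • x))
  · change (Ψ s).left (s • x) = C i s x
    rw [hΨ i s]
    exact congrArg (C i s) (inv_smul_smul s x)

end Cocycles

section Kurosh

open MulAction

variable {F X K ι : Type*} [Group F] [MulAction F X] [Group K] {S : ι → Subgroup F} {x₀ : X}

/-- Coset and double coset representatives adapted to a family of subgroups `S i` of a group
acting on `X` with base point `x₀`: a root in each `S i`-orbit, elements `shift i x` of `S i` which
move the root of the orbit of `x` to `x`, and a Schreier transversal `rep`, obtained by composing
shifts along roots of decreasing depth. -/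
structure KuroshSystem (S : ι → Subgroup F) (x₀ : X) where
  depth : X → ℕ
  root : ∀ i, orbitRel.Quotient (S i) X → X
  mk_root : ∀ i ω, (⟦root i ω⟧ : orbitRel.Quotient (S i) X) = ω
  shift : ι → X → F
  shift_mem : ∀ i x, shift i x ∈ S i
  shift_smul : ∀ i x, shift i x • root i ⟦x⟧ = x
  shift_root : ∀ i ω, shift i (root i ω) = 1
  rep : X → F
  rep_base : rep x₀ = 1
  rep_step : ∀ x, x ≠ x₀ → ∃ i, depth (root i ⟦x⟧) < depth x ∧ rep x = shift i x * rep (root i ⟦x⟧)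

theorem exists_depth [IsPretransitive F X] (hS : ⨆ i, S i = ⊤) (x₀ : X) :
    ∃ d : X → ℕ, ∀ x, x ≠ x₀ → ∃ i, ∃ s : S i, d (s • x) < d x := by
  let wordLengths (x : X) : Set ℕ :=
    {n | ∃ l : List F, l.length = n ∧ (∀ g ∈ l, ∃ i, g ∈ S i) ∧ l.prod • x₀ = x}
  have nonempty_wordLengths (x : X) : (wordLengths x).Nonempty := by
    obtain ⟨g, rfl⟩ := exists_smul_eq F x₀ x
    suffices h : ∃ l : List F, (∀ s ∈ l, ∃ i, s ∈ S i) ∧ l.prod = g by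
      obtain ⟨l, hl, rfl⟩ := h
      exact ⟨_, l, rfl, hl, rfl⟩
    have hg : g ∈ ⨆ i, S i := hS ▸ Subgroup.mem_top g
    induction hg using Subgroup.iSup_induction' with
    | hp i s hs => exact ⟨[s], by simpa using ⟨i, hs⟩, by simp⟩
    | h1 => exact ⟨[], by simp, rfl⟩
    | hmul _ _ _ _ hg hh =>
      obtain ⟨l, hl, rfl⟩ := hg
      obtain ⟨l', hl', rfl⟩ := hh
      exact ⟨l ++ l', fun s hs => (List.mem_append.1 hs).elim (hl s) (hl' s), List.prod_append⟩
  refine ⟨fun x => sInf (wordLengths x), fun x hx => ?_⟩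
  obtain ⟨l, hlength, hl, rfl⟩ := Nat.sInf_mem (nonempty_wordLengths x)
  cases l with
  | nil => simp at hx
  | cons s l =>
    obtain ⟨i, hs⟩ := hl s List.mem_cons_self
    refine ⟨i, ⟨s, hs⟩⁻¹, ?_⟩
    change sInf _ < sInf _
    rw [← hlength, List.length_cons, Nat.lt_succ_iff]
    exact Nat.sInf_le ⟨l, rfl, fun g hg => hl g (List.mem_cons_of_mem s hg), by
      simp [Subgroup.smul_def, mul_smul]⟩

theorem nonempty_kuroshSystem [IsPretransitive F X] (hS : ⨆ i, S i = ⊤) (x₀ : X) :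
    Nonempty (KuroshSystem S x₀) := by
  classical
  obtain ⟨d, hd⟩ := exists_depth hS x₀
  have exists_root (i : ι) (ω : orbitRel.Quotient (S i) X) :
      ∃ r : X, (⟦r⟧ : orbitRel.Quotient (S i) X) = ω ∧
        ∀ y : X, (⟦y⟧ : orbitRel.Quotient (S i) X) = ω → d r ≤ d y := by
    have hω : {y : X | (⟦y⟧ : orbitRel.Quotient (S i) X) = ω}.Nonempty := Quotient.exists_rep ω
    exact ⟨d.argminOn _ hω, d.argminOn_mem _ hω, fun y hy => d.argminOn_le _ hy⟩
  choose root mk_root root_le using exists_root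
  have exists_shift (i : ι) (x : X) :
      ∃ a ∈ S i, a • root i ⟦x⟧ = x ∧ (root i ⟦x⟧ = x → a = 1) := by
    by_cases hx : root i ⟦x⟧ = x
    · exact ⟨1, one_mem _, by rw [one_smul, hx], fun _ => rfl⟩
    · obtain ⟨s, hs⟩ := Quotient.exact (mk_root i ⟦x⟧).symm
      exact ⟨s, s.2, hs, fun h => absurd h hx⟩
  choose shift shift_mem shift_smul shift_eq_one using exists_shift
  have exists_root_lt (x : X) (hx : x ≠ x₀) : ∃ i, d (root i ⟦x⟧) < d x := by
    obtain ⟨i, s, hlt⟩ := hd x hx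
    exact ⟨i, (root_le i ⟦x⟧ _ (Quotient.sound ⟨s, rfl⟩)).trans_lt hlt⟩
  choose j root_lt using exists_root_lt
  let rep : X → F := (measure d).wf.fix fun x ih =>
    if h : x = x₀ then 1 else shift (j x h) x * ih (root (j x h) ⟦x⟧) (root_lt x h)
  have rep_eq (x : X) : rep x =
      if h : x = x₀ then 1 else shift (j x h) x * rep (root (j x h) ⟦x⟧) :=
    (measure d).wf.fix_eq _ x
  exact ⟨{
    depth := d, root, mk_root, shift, shift_mem, shift_smul, rep
    shift_root := fun i ω => shift_eq_one i _ (by rw [mk_root])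
    rep_base := by rw [rep_eq, dif_pos rfl]
    rep_step := fun x hx => ⟨j x hx, root_lt x hx, by rw [rep_eq, dif_neg hx]⟩ }⟩

/-- The cocycle with values in the stabilizer of the base point attached to a transversal. -/
def transversalCocycle {t : X → F} (ht : ∀ x, t x • x₀ = x) (g : F) (x : X) : stabilizer F x₀ :=
  ⟨(t (g • x))⁻¹ * g * t x, by
    rw [mem_stabilizer_iff, mul_smul, mul_smul, ht, inv_smul_eq_iff, ht]⟩

theorem isCocycle_transversalCocycle {t : X → F} (ht : ∀ x, t x • x₀ = x) :
    IsCocycle (transversalCocycle ht) := fun g h x =>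
  Subtype.ext (by simp [transversalCocycle, mul_smul, mul_assoc])

theorem orbitRel_mk_smul {i : ι} (s : S i) (x : X) :
    (⟦s • x⟧ : orbitRel.Quotient (S i) X) = ⟦x⟧ :=
  Quotient.sound ⟨s, rfl⟩

namespace KuroshSystem

variable (T : KuroshSystem S x₀)

theorem induction_on_depth {p : X → Prop} (base : p x₀) (step : ∀ i x, p (T.root i ⟦x⟧) →
    T.rep x = T.shift i x * T.rep (T.root i ⟦x⟧) → p x) (x : X) : p x := by
  induction hn : T.depth x using Nat.strong_induction_on generalizing x with
  | _ n ih =>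
    by_cases hx : x = x₀
    · rwa [hx]
    · obtain ⟨i, hlt, hrep⟩ := T.rep_step x hx
      exact step i x (ih _ (hn ▸ hlt) _ rfl) hrep

theorem rep_smul (x : X) : T.rep x • x₀ = x := by
  induction x using T.induction_on_depth with
  | base => rw [T.rep_base, one_smul]
  | step i x ih hrep => rw [hrep, mul_smul, ih, T.shift_smul]

/-- The transversal adapted to `S i`: on each `S i`-orbit it differs from the representative of the
root by an element of `S i`. -/
def factorRep (i : ι) (x : X) : F :=
  T.shift i x * T.rep (T.root i ⟦x⟧)

theorem factorRep_smul (i : ι) (x : X) : T.factorRep i x • x₀ = x := by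
  rw [factorRep, mul_smul, T.rep_smul, T.shift_smul]

theorem factorRep_root (i : ι) (ω : orbitRel.Quotient (S i) X) :
    T.factorRep i (T.root i ω) = T.rep (T.root i ω) := by
  rw [factorRep, T.shift_root, one_mul, T.mk_root]

/-- The vertex group of an `S i`-orbit: the stabilizer in `S i` of its root, transported to the
base point. -/
def vertex (k : Σ i, orbitRel.Quotient (S i) X) : Subgroup (stabilizer F x₀) :=
  (conjBy (T.rep (T.root k.1 k.2))⁻¹ (S k.1)).subgroupOf (stabilizer F x₀)

/-- The element of the stabilizer of the base point comparing the two transversals at `x`. -/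
def edge (i : ι) (x : X) : stabilizer F x₀ :=
  ⟨(T.rep x)⁻¹ * T.factorRep i x, by
    rw [mem_stabilizer_iff, mul_smul, T.factorRep_smul, inv_smul_eq_iff, T.rep_smul]⟩

theorem edge_root (i : ι) (ω : orbitRel.Quotient (S i) X) : T.edge i (T.root i ω) = 1 :=
  Subtype.ext (by simp [edge, factorRep_root])

theorem transversalCocycle_mem_vertex {i : ι} (s : S i) (x : X) :
    transversalCocycle (T.factorRep_smul i) (s : F) x ∈ T.vertex ⟨i, ⟦x⟧⟩ := by
  have hroot : (⟦(s : F) • x⟧ : orbitRel.Quotient (S i) X) = ⟦x⟧ := orbitRel_mk_smul s x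
  rw [vertex, Subgroup.mem_subgroupOf, mem_conjBy]
  have := mul_mem (mul_mem (inv_mem (T.shift_mem i ((s : F) • x))) s.2) (T.shift_mem i x)
  simpa [transversalCocycle, factorRep, hroot, mul_assoc] using this

theorem transversalCocycle_rep {i : ι} (s : S i) (x : X) :
    transversalCocycle T.rep_smul (s : F) x = T.edge i ((s : F) • x) *
      transversalCocycle (T.factorRep_smul i) (s : F) x * (T.edge i x)⁻¹ :=
  Subtype.ext (by simp [transversalCocycle, edge, mul_assoc])

theorem eq_top_of_vertex_le (hS : ⨆ i, S i = ⊤) {N : Subgroup (stabilizer F x₀)}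
    (hvertex : ∀ k, T.vertex k ≤ N) (hedge : ∀ i x, T.edge i x ∈ N) : N = ⊤ := by
  have hcocycle := isCocycle_transversalCocycle T.rep_smul
  have mem_N (g : F) (x : X) : transversalCocycle T.rep_smul g x ∈ N := by
    have hg : g ∈ ⨆ i, S i := hS ▸ Subgroup.mem_top g
    induction hg using Subgroup.iSup_induction' generalizing x with
    | hp i s hs =>
      rw [T.transversalCocycle_rep ⟨s, hs⟩]
      exact mul_mem (mul_mem (hedge _ _) (hvertex _ (T.transversalCocycle_mem_vertex ⟨s, hs⟩ x)))
        (inv_mem (hedge _ _))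
    | h1 => exact hcocycle.map_one x ▸ one_mem N
    | hmul g h _ _ hg hh => exact hcocycle g h x ▸ mul_mem (hg _) (hh _)
  refine (Subgroup.eq_top_iff' N).2 fun l => ?_
  convert mem_N l x₀
  exact Subtype.ext (by simp [transversalCocycle, mem_stabilizer_iff.1 l.2, T.rep_base])

theorem vertexHom_congr (e : ∀ k, T.vertex k →* K) {k k' : Σ i, orbitRel.Quotient (S i) X}
    (hk : k = k') {l l' : stabilizer F x₀} (hl : l = l') (hlk : l ∈ T.vertex k)
    (hlk' : l' ∈ T.vertex k') : e k ⟨l, hlk⟩ = e k' ⟨l', hlk'⟩ := by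
  subst hk hl
  rfl

/-- The cocycle of `S i` which extends to a cocycle of the whole group inducing the homomorphisms
`e` on the vertex groups and the values `γ` on the edges. -/
def factorCocycle (e : ∀ k, T.vertex k →* K) (γ : ι → X → K) (i : ι) (s : S i) (x : X) : K :=
  γ i (s • x) * e ⟨i, ⟦x⟧⟩ ⟨_, T.transversalCocycle_mem_vertex s x⟩ * (γ i x)⁻¹

theorem isCocycle_factorCocycle (e : ∀ k, T.vertex k →* K) (γ : ι → X → K) (i : ι) :
    IsCocycle (T.factorCocycle e γ i) := by
  intro s s' x
  have he : e ⟨i, ⟦x⟧⟩ ⟨_, T.transversalCocycle_mem_vertex (s * s') x⟩ =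
      e ⟨i, ⟦s' • x⟧⟩ ⟨_, T.transversalCocycle_mem_vertex s (s' • x)⟩ *
        e ⟨i, ⟦x⟧⟩ ⟨_, T.transversalCocycle_mem_vertex s' x⟩ := by
    have hmem := T.transversalCocycle_mem_vertex s (s' • x)
    rw [T.vertexHom_congr e (congrArg (Sigma.mk i) (orbitRel_mk_smul s' x)) rfl hmem
      (orbitRel_mk_smul s' x ▸ hmem), ← map_mul]
    exact T.vertexHom_congr e rfl (isCocycle_transversalCocycle (T.factorRep_smul i) s s' x) _ _
  simp only [factorCocycle, he, mul_smul]
  group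

section Extension

variable {T} {e : ∀ k, T.vertex k →* K} {γ : ι → X → K} {c : F → X → K} (hc : IsCocycle c)
  (hcS : ∀ i (s : S i), c s = T.factorCocycle e γ i s) (hγ : ∀ i x, T.edge i x = 1 → γ i x = 1)

include hcS hγ

theorem apply_shift (i : ι) (x : X) : c (T.shift i x) (T.root i ⟦x⟧) = γ i x := by
  have hcocycle : transversalCocycle (T.factorRep_smul i) (T.shift i x) (T.root i ⟦x⟧) = 1 :=
    Subtype.ext (by
      simp only [transversalCocycle, T.shift_smul, T.factorRep_root]
      simp [factorRep])
  have he : e ⟨i, ⟦T.root i ⟦x⟧⟧⟩ ⟨_, T.transversalCocycle_mem_vertex ⟨_, T.shift_mem i x⟩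
      (T.root i ⟦x⟧)⟩ = 1 :=
    (T.vertexHom_congr e rfl hcocycle _ (one_mem _)).trans (map_one _)
  rw [hcS i ⟨_, T.shift_mem i x⟩, factorCocycle, he, hγ _ _ (T.edge_root i ⟦x⟧)]
  simp [Subgroup.smul_def, T.shift_smul]

include hc

theorem apply_rep (x : X) : c (T.rep x) x₀ = 1 := by
  induction x using T.induction_on_depth with
  | base => rw [T.rep_base, hc.map_one]
  | step i x ih hrep =>
    rw [hrep, hc, T.rep_smul, ih, mul_one, apply_shift hcS hγ]
    exact hγ i x (Subtype.ext (by simp [edge, factorRep, hrep]))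

theorem apply_edge (i : ι) (x : X) : c (T.edge i x) x₀ = γ i x := by
  rw [edge, hc.map_inv_mul ((T.rep_smul x).trans (T.factorRep_smul i x).symm),
    apply_rep hc hcS hγ, factorRep, hc, T.rep_smul, apply_rep hc hcS hγ, apply_shift hcS hγ]
  simp

theorem apply_vertex (k : Σ i, orbitRel.Quotient (S i) X) (l : T.vertex k) :
    c (l : stabilizer F x₀) x₀ = e k l := by
  obtain ⟨i, ω⟩ := k
  obtain ⟨⟨l, hl⟩, hlk⟩ := l
  set r := T.root i ω
  let s : S i := ⟨T.rep r * l * (T.rep r)⁻¹, by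
    simpa [vertex, Subgroup.mem_subgroupOf, mem_conjBy, mul_assoc] using hlk⟩
  have hs : (s : F) * T.rep r = T.rep r * l := by simp [s]
  have hs_smul : s • r = r := by
    conv_lhs => rw [← T.rep_smul r]
    rw [Subgroup.smul_def, ← mul_smul, hs, mul_smul, mem_stabilizer_iff.1 hl, T.rep_smul]
  have hl_eq : transversalCocycle (T.factorRep_smul i) (s : F) r = ⟨l, hl⟩ :=
    Subtype.ext (by
      simp only [transversalCocycle, ← Subgroup.smul_def, hs_smul, r, T.factorRep_root]
      simp [s, r, mul_assoc])
  have hγr : γ i r = 1 := hγ i r (T.edge_root i ω)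
  calc
    c l x₀ = c ((T.rep r)⁻¹ * (s * T.rep r)) x₀ := by rw [hs, inv_mul_cancel_left]
    _ = c s r := by
      rw [hc.map_inv_mul, apply_rep hc hcS hγ, hc, T.rep_smul, apply_rep hc hcS hγ]
      · simp
      · rw [hs, mul_smul, mem_stabilizer_iff.1 hl]
    _ = e ⟨i, ⟦r⟧⟩ ⟨_, T.transversalCocycle_mem_vertex s r⟩ := by
      rw [hcS, factorCocycle, hs_smul, hγr, one_mul, inv_one, mul_one]
    _ = e ⟨i, ω⟩ ⟨⟨l, hl⟩, hlk⟩ :=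
      T.vertexHom_congr e (congrArg (Sigma.mk i) (T.mk_root i ω)) hl_eq _ _

end Extension

theorem exists_hom (hS : IsFreeProduct S) (e : ∀ k, T.vertex k →* K) (γ : ι → X → K)
    (hγ : ∀ i x, T.edge i x = 1 → γ i x = 1) :
    ∃ f : stabilizer F x₀ →* K,
      (∀ k (l : T.vertex k), f l = e k l) ∧ ∀ i x, f (T.edge i x) = γ i x := by
  obtain ⟨c, hc, hcS⟩ := hS.exists_cocycle (T.isCocycle_factorCocycle e γ)
  exact ⟨hc.stabilizerHom x₀, apply_vertex hc hcS hγ, apply_edge hc hcS hγ⟩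

theorem isFreeFactorFamily_vertex (hS : IsFreeProduct S) : IsFreeFactorFamily T.vertex := by
  let B : Subgroup (stabilizer F x₀) :=
    Subgroup.closure (Set.range fun k : ι × X => T.edge k.1 k.2)
  have edge_mem (i : ι) (x : X) : T.edge i x ∈ B := Subgroup.subset_closure ⟨(i, x), rfl⟩
  let U : Option (Σ i, orbitRel.Quotient (S i) X) → Subgroup (stabilizer F x₀) :=
    fun o => o.elim B T.vertex
  obtain ⟨f, hf_vertex, hf_edge⟩ := T.exists_hom hS (fun k => inclCoprodI U (some k))
    (fun i x => inclCoprodI U none ⟨T.edge i x, edge_mem i x⟩) fun i x hx =>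
      (congrArg (inclCoprodI U none) (Subtype.ext hx)).trans (map_one _)
  refine ⟨B, isFreeProduct_of_hom ?_ f ?_⟩
  · exact T.eq_top_of_vertex_le hS.iSup_eq_top (fun k => le_iSup U (some k))
      fun i x => le_iSup U none (edge_mem i x)
  · rintro (_ | k) l
    · have : f.comp B.subtype = inclCoprodI U none :=
        MonoidHom.eq_of_eqOn_dense Subgroup.closure_closure_coe_preimage <| by
          rintro ⟨_, _⟩ ⟨⟨i, x⟩, rfl⟩
          exact hf_edge i x
      exact DFunLike.congr_fun this l
    · exact hf_vertex k l

end KuroshSystem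

/-- The Kurosh subgroup theorem for point stabilizers, without the freeness of the complement. -/
theorem IsFreeProduct.exists_isFreeFactorFamily_stabilizer [IsPretransitive F X]
    (hS : IsFreeProduct S) (x₀ : X) :
    ∃ d : ∀ i, orbitRel.Quotient (S i) X → F,
      (∀ i ω, (⟦d i ω • x₀⟧ : orbitRel.Quotient (S i) X) = ω) ∧
      IsFreeFactorFamily fun k : Σ i, orbitRel.Quotient (S i) X =>
        (conjBy (d k.1 k.2)⁻¹ (S k.1)).subgroupOf (stabilizer F x₀) := by
  obtain ⟨T⟩ := nonempty_kuroshSystem hS.iSup_eq_top x₀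
  exact ⟨fun i ω => T.rep (T.root i ω), fun i ω => by rw [T.rep_smul, T.mk_root],
    T.isFreeFactorFamily_vertex hS⟩

end Kurosh

section Preimage

variable {F L : Type*} [Group F] [Group L]

theorem Carries.refl (𝒜 : Set (Subgroup F)) : Carries 𝒜 𝒜 :=
  fun A hA => ⟨A, hA, 1, (conjBy_one A).ge⟩

theorem Carries.trans {𝒜 ℬ 𝒞 : Set (Subgroup F)} (hℬ : Carries 𝒜 ℬ) (h𝒞 : Carries ℬ 𝒞) :
    Carries 𝒜 𝒞 := by
  intro C hC
  obtain ⟨B, hB, x, hCB⟩ := h𝒞 C hC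
  obtain ⟨A, hA, y, hBA⟩ := hℬ B hB
  exact ⟨A, hA, x * y, hCB.trans (conjBy_conjBy x y A ▸ conjBy_mono x hBA)⟩

theorem Carries.map {𝒜 ℬ : Set (Subgroup F)} (h : Carries 𝒜 ℬ) (φ : F →* F) :
    Carries (mapSystem φ 𝒜) (mapSystem φ ℬ) := by
  rintro _ ⟨B, hB, rfl⟩
  obtain ⟨A, hA, x, hBA⟩ := h B hB
  exact ⟨_, ⟨A, hA, rfl⟩, φ x, map_conjBy φ x A ▸ Subgroup.map_mono hBA⟩

open MulAction in
theorem IsFreeProduct.exists_isFreeFactorFamily_comap {ι : Type*} {S : ι → Subgroup F}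
    (hS : IsFreeProduct S) {ψ : L →* F} (hψ : Function.Injective ψ) :
    ∃ d : ∀ i, orbitRel.Quotient (S i) (F ⧸ ψ.range) → F,
      (IsFreeFactorFamily fun k : Σ i, orbitRel.Quotient (S i) (F ⧸ ψ.range) =>
        (conjBy (d k.1 k.2)⁻¹ (S k.1)).comap ψ) ∧
      ∀ i x, ∃ ω l, (conjBy x (S i)).comap ψ = conjBy l ((conjBy (d i ω)⁻¹ (S i)).comap ψ) := by
  obtain ⟨d, hd, hfamily⟩ :=
    hS.exists_isFreeFactorFamily_stabilizer ((1 : F) : F ⧸ ψ.range)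
  let e : L ≃* stabilizer F ((1 : F) : F ⧸ ψ.range) :=
    (MonoidHom.ofInjective hψ).trans (MulEquiv.subgroupCongr (stabilizer_quotient _).symm)
  refine ⟨d, ?_, fun i x => ?_⟩
  · have := hfamily.map e.symm
    simp only [MulEquiv.toMonoidHom_eq_coe, Subgroup.map_equiv_eq_comap_symm] at this
    exact this
  · let ω : orbitRel.Quotient (S i) (F ⧸ ψ.range) := ⟦x⁻¹ • ((1 : F) : F ⧸ ψ.range)⟧
    obtain ⟨s, hs⟩ := Quotient.exact (hd i ω)
    obtain ⟨l, hl⟩ : x * (s : F)⁻¹ * d i ω ∈ ψ.range := by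
      rw [← stabilizer_quotient ψ.range, mem_stabilizer_iff, mul_smul, ← hs]
      simp [Subgroup.smul_def]
    refine ⟨ω, l, ?_⟩
    rw [conjBy_comap, hl, conjBy_conjBy, mul_inv_cancel_right, ← conjBy_conjBy,
      conjBy_of_mem (inv_mem s.2)]

/-- `𝒮` is the system of preimages of `𝒜` under `ψ`: a free factor family consisting, up to
conjugacy, of the nontrivial preimages of the conjugates of the components of `𝒜`. -/
structure IsPreimageSystem (ψ : L →* F) (𝒜 : Set (Subgroup F)) (𝒮 : Set (Subgroup L)) :
    Prop where
  isFreeFactorFamily : IsFreeFactorFamily fun P : 𝒮 => (P : Subgroup L)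
  ne_bot : ∀ P ∈ 𝒮, P ≠ ⊥
  exists_eq_comap : ∀ P ∈ 𝒮, ∃ A ∈ 𝒜, ∃ x, P = (conjBy x A).comap ψ
  exists_conjBy_eq : ∀ A ∈ 𝒜, ∀ x, (conjBy x A).comap ψ ≠ ⊥ →
    ∃ P ∈ 𝒮, ∃ l, (conjBy x A).comap ψ = conjBy l P

theorem exists_isPreimageSystem {𝒜 : Set (Subgroup F)}
    (h𝒜 : IsFreeFactorFamily fun A : 𝒜 => (A : Subgroup F)) {ψ : L →* F}
    (hψ : Function.Injective ψ) : ∃ 𝒮, IsPreimageSystem ψ 𝒜 𝒮 := by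
  obtain ⟨B, hB⟩ := h𝒜
  obtain ⟨d, hfamily, hconj⟩ := hB.exists_isFreeFactorFamily_comap hψ
  refine ⟨{P | P ≠ ⊥ ∧ ∃ (A : 𝒜) (ω : _), P = (conjBy (d (some A) ω)⁻¹ A).comap ψ},
    hfamily.coe_of_subset_range ?_, fun P hP => hP.1, ?_, ?_⟩
  · rintro _ ⟨-, A, ω, rfl⟩
    exact ⟨⟨some A, ω⟩, rfl⟩
  · rintro _ ⟨-, A, ω, rfl⟩
    exact ⟨A, A.2, _, rfl⟩
  · intro A hA x hne
    obtain ⟨ω, l, hl⟩ := hconj (some ⟨A, hA⟩) x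
    refine ⟨_, ⟨fun hbot => hne ?_, ⟨A, hA⟩, ω, rfl⟩, l, hl⟩
    exact hl.trans (conjBy_eq_bot_iff.2 hbot)

theorem IsPreimageSystem.nonempty {ψ : L →* F} {𝒜 : Set (Subgroup F)} {𝒮 : Set (Subgroup L)}
    (h : IsPreimageSystem ψ 𝒜 𝒮) {A : Subgroup F} (hA : A ∈ 𝒜) {Q : Subgroup L} (hQ : Q ≠ ⊥)
    {x : F} (hQA : Q.map ψ ≤ conjBy x A) : 𝒮.Nonempty := by
  obtain ⟨P, hP, -⟩ := h.exists_conjBy_eq A hA x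
    (ne_bot_of_le_ne_bot hQ (Subgroup.map_le_iff_le_comap.1 hQA))
  exact ⟨P, hP⟩

theorem IsPreimageSystem.carries_iff {φ : F →* F} {𝒜 𝒮 : Set (Subgroup F)}
    (h : IsPreimageSystem φ 𝒜 𝒮) (h𝒮 : 𝒮.Nonempty) {ℬ : Set (Subgroup F)} :
    Carries 𝒮 ℬ ↔ Carries 𝒜 (mapSystem φ ℬ) := by
  constructor
  · rintro hℬ _ ⟨B, hB, rfl⟩
    obtain ⟨P, hP, l, hBP⟩ := hℬ B hB
    obtain ⟨A, hA, x, rfl⟩ := h.exists_eq_comap P hP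
    refine ⟨A, hA, φ l * x, Subgroup.map_le_iff_le_comap.2 ?_⟩
    rwa [← conjBy_conjBy, ← conjBy_comap]
  · intro hℬ B hB
    obtain ⟨A, hA, x, hBA⟩ := hℬ _ ⟨B, hB, rfl⟩
    by_cases hB_bot : B = ⊥
    · exact ⟨h𝒮.some, h𝒮.some_mem, 1, hB_bot ▸ bot_le⟩
    · have hB_le := Subgroup.map_le_iff_le_comap.1 hBA
      obtain ⟨P, hP, l, hl⟩ := h.exists_conjBy_eq A hA x (ne_bot_of_le_ne_bot hB_bot hB_le)
      exact ⟨P, hP, l, hB_le.trans_eq hl⟩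

end Preimage

section Complexity

theorem finite_monoidHom (G K : Type*) [Group G] [Group.FG G] [Group K] [Finite K] :
    Finite (G →* K) := by
  obtain ⟨s, hs⟩ := Group.FG.out (G := G)
  refine Finite.of_injective (fun (f : G →* K) (g : s) => f g) fun f f' hff' => ?_
  exact MonoidHom.eq_of_eqOn_dense hs fun g hg => congrFun hff' ⟨g, hg⟩

theorem exists_hom_ne_one (G : Type*) [Group G] [IsFreeGroup G] [Nontrivial G] :
    ∃ χ : G →* Multiplicative (ZMod 2), χ ≠ 1 := by
  obtain ⟨a⟩ : Nonempty (IsFreeGroup.Generators G) := by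
    by_contra hempty
    have hid : MonoidHom.id G = 1 := IsFreeGroup.ext_hom fun a => (hempty ⟨a⟩).elim
    obtain ⟨g, hg⟩ := exists_ne (1 : G)
    exact hg (DFunLike.congr_fun hid g)
  refine ⟨IsFreeGroup.lift fun _ => Multiplicative.ofAdd 1, fun h => ?_⟩
  have : Multiplicative.ofAdd (1 : ZMod 2) = 1 := by
    simpa only [IsFreeGroup.lift_of, MonoidHom.one_apply] using
      DFunLike.congr_fun h (IsFreeGroup.of a)
  exact absurd this (by decide)

variable {F : Type*} [Group F] {𝒮 𝒯 : Set (Subgroup F)}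

theorem exists_hom_ne_one_of_ne_bot [IsFreeGroup F] {P : Subgroup F} (hP : P ≠ ⊥) :
    ∃ χ : P →* Multiplicative (ZMod 2), χ ≠ 1 :=
  have := (Subgroup.nontrivial_iff_ne_bot P).2 hP
  exists_hom_ne_one P

theorem IsFreeFactorFamily.finite_index [IsFreeGroup F] [Group.FG F] {ι : Type*}
    {S : ι → Subgroup F} (h : IsFreeFactorFamily S) (hS : ∀ i, S i ≠ ⊥) : Finite ι := by
  choose χ hχ using fun i => exists_hom_ne_one_of_ne_bot (hS i)
  choose f hf hf_ker using fun i => h.exists_extension i (χ i)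
  have := finite_monoidHom F (Multiplicative (ZMod 2))
  refine Finite.of_injective f fun i j hij => ?_
  by_contra hne
  exact hχ i (MonoidHom.ext fun s => by rw [← hf i, hij]; exact hf_ker j i hne s.2)

theorem IsFreeFactorFamily.exists_le_ker_of_ne_top [IsFreeGroup F] {ι : Type*}
    {S : ι → Subgroup F} (h : IsFreeFactorFamily S) {i : ι} (hi : S i ≠ ⊤) :
    ∃ χ : F →* Multiplicative (ZMod 2), χ ≠ 1 ∧ S i ≤ χ.ker := by
  obtain ⟨B, hB⟩ := h.comp_injective (Function.injective_of_subsingleton fun _ : Unit => i)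
  have hB_ne : B ≠ ⊥ := fun hbot => hi (by simpa [iSup_option, hbot] using hB.iSup_eq_top)
  obtain ⟨χ, hχ⟩ := exists_hom_ne_one_of_ne_bot hB_ne
  obtain ⟨f, hf⟩ := hB.exists_hom fun
    | none => χ
    | some _ => 1
  refine ⟨f, fun hf_one => hχ (MonoidHom.ext fun b => ?_), fun s hs => hf (some ()) ⟨s, hs⟩⟩
  exact (hf none b).symm.trans (DFunLike.congr_fun hf_one (b : F))

theorem exists_subgroupOf_le_ker [IsFreeGroup F]
    (h𝒮 : IsFreeFactorFamily fun P : 𝒮 => (P : Subgroup F)) {P : Subgroup F} (hP : P ∈ 𝒮)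
    (hP_bot : P ≠ ⊥) {x : F} {T : Subgroup F} (hlt : conjBy x P < T) :
    ∃ χ : T →* Multiplicative (ZMod 2), χ ≠ 1 ∧ (conjBy x P).subgroupOf T ≤ χ.ker := by
  obtain ⟨𝒬, h𝒬⟩ := exists_isPreimageSystem h𝒮 T.subtype_injective
  have hne : (conjBy x P).subgroupOf T ≠ ⊥ := by
    rw [Ne, Subgroup.subgroupOf_eq_bot, disjoint_of_le_iff_left_eq_bot hlt.le]
    exact conjBy_eq_bot_iff.not.2 hP_bot
  obtain ⟨Q, hQ, l, hl⟩ := h𝒬.exists_conjBy_eq P hP x hne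
  have hQ_top : Q ≠ ⊤ := by
    rintro rfl
    rw [conjBy_of_normal l ⊤] at hl
    exact hlt.not_ge (Subgroup.subgroupOf_eq_top.1 hl)
  obtain ⟨χ, hχ, hQχ⟩ := h𝒬.isFreeFactorFamily.exists_le_ker_of_ne_top (i := ⟨Q, hQ⟩) hQ_top
  refine ⟨χ, hχ, ?_⟩
  exact (hl.trans_le (conjBy_mono l hQχ)).trans_eq (conjBy_of_normal l χ.ker)

/-- The homomorphisms to `K` which are trivial on all components of the system `𝒮`. -/
def annihilator (K : Type*) [Group K] (𝒮 : Set (Subgroup F)) : Set (F →* K) :=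
  {χ | ∀ P ∈ 𝒮, P ≤ χ.ker}

theorem Carries.annihilator_subset {K : Type*} [Group K] (h : Carries 𝒯 𝒮) :
    annihilator K 𝒯 ⊆ annihilator K 𝒮 := by
  intro χ hχ P hP
  obtain ⟨T, hT, x, hPT⟩ := h P hP
  exact hPT.trans ((conjBy_mono x (hχ T hT)).trans_eq (conjBy_of_normal x χ.ker))

section CarryingMap

variable {m : 𝒮 → 𝒯} {x : 𝒮 → F} (hm : ∀ P : 𝒮, conjBy (x P) P ≤ m P)
  (h𝒯 : IsFreeFactorFamily fun T : 𝒯 => (T : Subgroup F))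

include hm h𝒯

theorem eq_one_of_annihilator_subset {K : Type*} [Group K]
    (hann : annihilator K 𝒮 ⊆ annihilator K 𝒯) {T : 𝒯} {χ : (T : Subgroup F) →* K}
    (hχ : ∀ P, m P = T → (conjBy (x P) P).subgroupOf T ≤ χ.ker) : χ = 1 := by
  obtain ⟨f, hf, hf_ker⟩ := h𝒯.exists_extension T χ
  have hf𝒮 : f ∈ annihilator K 𝒮 := fun P hP => by
    rw [← conjBy_of_normal (x ⟨P, hP⟩)⁻¹ f.ker, ← conjBy_le_iff]
    by_cases hmT : m ⟨P, hP⟩ = T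
    · intro g hg
      have hgT : g ∈ (T : Subgroup F) := hmT ▸ hm ⟨P, hP⟩ hg
      exact (hf ⟨g, hgT⟩).trans (hχ ⟨P, hP⟩ hmT hg)
    · exact (hm ⟨P, hP⟩).trans (hf_ker _ hmT)
  exact MonoidHom.ext fun t => (hf t).symm.trans (hann hf𝒮 T T.2 t.2)

variable [IsFreeGroup F] (hann : annihilator (Multiplicative (ZMod 2)) 𝒮 ⊆
  annihilator (Multiplicative (ZMod 2)) 𝒯)

include hann

theorem surjective_of_annihilator_subset (h𝒯_bot : ∀ T ∈ 𝒯, T ≠ ⊥) : Function.Surjective m := by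
  intro T
  by_contra! hT
  obtain ⟨χ, hχ⟩ := exists_hom_ne_one_of_ne_bot (h𝒯_bot T T.2)
  exact hχ (eq_one_of_annihilator_subset hm h𝒯 hann fun P hP => absurd hP (hT P))

theorem conjBy_eq_of_annihilator_subset (h𝒮 : IsFreeFactorFamily fun P : 𝒮 => (P : Subgroup F))
    (h𝒮_bot : ∀ P ∈ 𝒮, P ≠ ⊥) (hinj : Function.Injective m) (P : 𝒮) :
    conjBy (x P) P = m P := by
  by_contra hne
  obtain ⟨χ, hχ, hPχ⟩ := exists_subgroupOf_le_ker h𝒮 P.2 (h𝒮_bot P P.2) ((hm P).lt_of_ne hne)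
  refine hχ (eq_one_of_annihilator_subset hm h𝒯 hann fun P' hP' => ?_)
  rwa [hinj hP']

end CarryingMap

/-- The complexity of a system: the number of homomorphisms to `ℤ/2` annihilating it, and then the
number of its components. It decreases strictly along strictly ascending chains of free factor
systems. -/
noncomputable def complexity (𝒮 : Set (Subgroup F)) : ℕ ×ₗ ℕ :=
  toLex ((annihilator (Multiplicative (ZMod 2)) 𝒮).ncard, 𝒮.ncard)

theorem Carries.symm_of_complexity_le [IsFreeGroup F] [Group.FG F]
    (h𝒮 : IsNontrivialFreeFactorSystem 𝒮) (h𝒯 : IsNontrivialFreeFactorSystem 𝒯)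
    (hcarries : Carries 𝒯 𝒮) (hle : complexity 𝒮 ≤ complexity 𝒯) : Carries 𝒮 𝒯 := by
  obtain ⟨h𝒮_fin, -, h𝒮_bot, h𝒮_family⟩ := isNontrivialFreeFactorSystem_iff.1 h𝒮
  obtain ⟨-, -, h𝒯_bot, h𝒯_family⟩ := isNontrivialFreeFactorSystem_iff.1 h𝒯
  have := finite_monoidHom F (Multiplicative (ZMod 2))
  have hsub := hcarries.annihilator_subset (K := Multiplicative (ZMod 2))
  obtain hlt | ⟨hcard_ann, hcard⟩ := Prod.Lex.toLex_le_toLex.1 hle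
  · exact absurd (Set.ncard_le_ncard hsub) hlt.not_ge
  have hann := (Set.eq_of_subset_of_ncard_le hsub hcard_ann.le).ge
  have exists_conj (P : 𝒮) : ∃ (T : 𝒯) (x : F), conjBy x (P : Subgroup F) ≤ T := by
    obtain ⟨T, hT, x, hPT⟩ := hcarries P P.2
    exact ⟨⟨T, hT⟩, x⁻¹, conjBy_le_iff.2 (by rwa [inv_inv])⟩
  choose m x hm using exists_conj
  have hsurj := surjective_of_annihilator_subset hm h𝒯_family hann h𝒯_bot
  have hinj : Function.Injective m := by
    have : Finite 𝒮 := h𝒮_fin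
    have : Finite 𝒯 := Finite.of_surjective m hsurj
    exact (hsurj.bijective_of_nat_card_le hcard).1
  intro T hT
  obtain ⟨P, hP⟩ := hsurj ⟨T, hT⟩
  refine ⟨P, P.2, x P, ?_⟩
  rw [conjBy_eq_of_annihilator_subset hm h𝒯_family hann h𝒮_family h𝒮_bot hinj, hP]

theorem exists_carries_of_monotone [IsFreeGroup F] [Group.FG F] {𝒮 : ℕ → Set (Subgroup F)}
    (h𝒮 : ∀ k, IsNontrivialFreeFactorSystem (𝒮 k)) (hmono : ∀ k l, k ≤ l → Carries (𝒮 l) (𝒮 k)) :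
    ∃ k, ∀ l, Carries (𝒮 k) (𝒮 l) := by
  let k := Function.argmin fun k => complexity (𝒮 k)
  refine ⟨k, fun l => ?_⟩
  have hle : complexity (𝒮 k) ≤ complexity (𝒮 (max k l)) :=
    Function.argmin_le (fun k => complexity (𝒮 k)) _
  exact (Carries.symm_of_complexity_le (h𝒮 k) (h𝒮 _) (hmono _ _ (le_max_left k l)) hle).trans
    (hmono _ _ (le_max_right k l))

end Complexity

section Elliptic

variable {F : Type*} [Group F] {φ : F →* F} {𝒜 ℬ ℰ : Set (Subgroup F)}

theorem exists_hom_map_eq_iterate (hφ : Function.Injective φ) (k : ℕ) :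
    ∃ ψ : F →* F, Function.Injective ψ ∧ ∀ A : Subgroup F, A.map ψ = (Subgroup.map φ)^[k] A := by
  induction k with
  | zero => exact ⟨MonoidHom.id F, Function.injective_id, Subgroup.map_id⟩
  | succ k ih =>
    obtain ⟨ψ, hψ, hmap⟩ := ih
    refine ⟨φ.comp ψ, hφ.comp hψ, fun A => ?_⟩
    rw [← Subgroup.map_map, hmap, Function.iterate_succ_apply']

theorem exists_hom_mapSystem_eq_iterate (hφ : Function.Injective φ) (k : ℕ) :
    ∃ ψ : F →* F, Function.Injective ψ ∧ mapSystem ψ = (mapSystem φ)^[k] ∧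
      ∀ A : Subgroup F, A.map ψ = (Subgroup.map φ)^[k] A := by
  obtain ⟨ψ, hψ, hmap⟩ := exists_hom_map_eq_iterate hφ k
  refine ⟨ψ, hψ, ?_, hmap⟩
  change Set.image (Subgroup.map ψ) = (Set.image (Subgroup.map φ))^[k]
  rw [← Set.image_iterate_eq, funext hmap]

theorem IsFixed.exists_iterate_map_eq (h : IsFixed φ 𝒜) (k : ℕ) {A : Subgroup F} (hA : A ∈ 𝒜) :
    ∃ A' ∈ 𝒜, ∃ x, (Subgroup.map φ)^[k] A = conjBy x A' := by
  obtain ⟨σ, hσ⟩ := h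
  induction k with
  | zero => exact ⟨A, hA, 1, (conjBy_one A).symm⟩
  | succ k ih =>
    obtain ⟨A', hA', x, hx⟩ := ih
    obtain ⟨y, hy⟩ := hσ ⟨A', hA'⟩
    refine ⟨σ ⟨A', hA'⟩, (σ ⟨A', hA'⟩).2, φ x * y, ?_⟩
    rw [Function.iterate_succ_apply', hx, map_conjBy, hy, conjBy_conjBy]

theorem IsFixed.isInvariant (h : IsFixed φ 𝒜) : IsInvariant φ 𝒜 := by
  rintro _ ⟨A, hA, rfl⟩
  obtain ⟨A', hA', x, hx⟩ := h.exists_iterate_map_eq 1 hA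
  exact ⟨A', hA', x, hx.le⟩

theorem IsInvariant.carries_iterate_of_le (h : IsInvariant φ 𝒜) {k l : ℕ} (hkl : k ≤ l)
    (hk : Carries 𝒜 ((mapSystem φ)^[k] ℬ)) : Carries 𝒜 ((mapSystem φ)^[l] ℬ) := by
  induction l, hkl using Nat.le_induction with
  | base => exact hk
  | succ l _ ih => exact h.trans (Function.iterate_succ_apply' (mapSystem φ) l ℬ ▸ ih.map φ)

theorem IsInvariant.exists_preimageSystem [IsFreeGroup F] [Group.FG F] (h : IsInvariant φ 𝒜)
    (hφ : Function.Injective φ) (h𝒜 : IsNontrivialFreeFactorSystem 𝒜) (k : ℕ) :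
    ∃ 𝒮, IsNontrivialFreeFactorSystem 𝒮 ∧
      ∀ ℬ, Carries 𝒮 ℬ ↔ Carries 𝒜 ((mapSystem φ)^[k] ℬ) := by
  obtain ⟨-, ⟨A, hA⟩, h𝒜_bot, h𝒜_family⟩ := isNontrivialFreeFactorSystem_iff.1 h𝒜
  obtain ⟨ψ, hψ, hψ_map, -⟩ := exists_hom_mapSystem_eq_iterate hφ k
  obtain ⟨𝒮, h𝒮⟩ := exists_isPreimageSystem h𝒜_family hψ
  have hψ𝒜 : Carries 𝒜 (mapSystem ψ 𝒜) :=
    hψ_map ▸ h.carries_iterate_of_le (Nat.zero_le k) (Carries.refl 𝒜)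
  obtain ⟨A', hA', x, hx⟩ := hψ𝒜 _ ⟨A, hA, rfl⟩
  have h𝒮_nonempty := h𝒮.nonempty hA' (h𝒜_bot A hA) hx
  refine ⟨𝒮, isNontrivialFreeFactorSystem_iff.2 ⟨?_, h𝒮_nonempty, h𝒮.ne_bot,
    h𝒮.isFreeFactorFamily⟩, fun ℬ => hψ_map ▸ h𝒮.carries_iff h𝒮_nonempty⟩
  exact h𝒮.isFreeFactorFamily.finite_index fun P => h𝒮.ne_bot P P.2

theorem IsInvariant.exists_greatest_isEventuallyCarried_of_isNontrivial [IsFreeGroup F]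
    [Group.FG F] (h : IsInvariant φ 𝒜) (hφ : Function.Injective φ)
    (h𝒜 : IsNontrivialFreeFactorSystem 𝒜) :
    ∃ ℰ, IsEventuallyCarried φ 𝒜 ℰ ∧ ∀ ℬ, IsEventuallyCarried φ 𝒜 ℬ → Carries ℰ ℬ := by
  choose 𝒮 h𝒮 carries_iff using h.exists_preimageSystem hφ h𝒜
  have carries_self (k : ℕ) : Carries 𝒜 ((mapSystem φ)^[k] (𝒮 k)) :=
    (carries_iff k _).1 (Carries.refl _)
  obtain ⟨k, hk⟩ := exists_carries_of_monotone h𝒮 fun k l hkl =>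
    (carries_iff l _).2 (h.carries_iterate_of_le hkl (carries_self k))
  refine ⟨𝒮 k, ⟨Or.inr (h𝒮 k), ?invariant, ?carries, k, carries_self k⟩, fun ℬ hℬ => ?greatest⟩
  case invariant =>
    rw [IsInvariant, carries_iff, ← Function.iterate_succ_apply]
    exact h.carries_iterate_of_le k.le_succ (carries_self k)
  case carries =>
    exact (carries_iff k 𝒜).2 (h.carries_iterate_of_le k.zero_le (Carries.refl 𝒜))
  case greatest =>
    obtain ⟨l, hl⟩ := hℬ.eventually
    exact (hk l).trans ((carries_iff l ℬ).2 hl)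

theorem IsEventuallyCarried.eq_singleton_bot (hφ : Function.Injective φ)
    (h : IsEventuallyCarried φ {⊥} ℬ) : ℬ = {⊥} := by
  refine h.system.resolve_right fun hℬ => ?_
  obtain ⟨k, hk⟩ := h.eventually
  obtain ⟨ψ, hψ, hψ_map, -⟩ := exists_hom_mapSystem_eq_iterate hφ k
  obtain ⟨B, hB⟩ := hℬ.nonempty
  obtain ⟨_, rfl, x, hx⟩ := hk (B.map ψ) (hψ_map ▸ ⟨B, hB, rfl⟩)
  rw [conjBy_bot, le_bot_iff, Subgroup.map_eq_bot_iff_of_injective _ hψ] at hx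
  exact hℬ.ne_bot B hB hx

theorem IsInvariant.exists_greatest_isEventuallyCarried [IsFreeGroup F] [Group.FG F]
    (h : IsInvariant φ 𝒜) (hφ : Function.Injective φ) (h𝒜 : IsFreeFactorSystem 𝒜) :
    ∃ ℰ, IsEventuallyCarried φ 𝒜 ℰ ∧ ∀ ℬ, IsEventuallyCarried φ 𝒜 ℬ → Carries ℰ ℬ := by
  rcases h𝒜 with rfl | h𝒜
  · refine ⟨{⊥}, ⟨Or.inl rfl, h, Carries.refl _, 0, Carries.refl _⟩, fun ℬ hℬ => ?_⟩
    rw [hℬ.eq_singleton_bot hφ]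
    exact Carries.refl _
  · exact h.exists_greatest_isEventuallyCarried_of_isNontrivial hφ h𝒜

theorem exists_conjBy_mem_of_carries {ψ : F →* F} (hψ : Function.Injective ψ)
    (h𝒜 : IsFreeFactorFamily fun A : 𝒜 => (A : Subgroup F)) (h𝒜_bot : ∀ A ∈ 𝒜, A ≠ ⊥)
    {A A₁ : Subgroup F} (hA : A ∈ 𝒜) (hA₁ : A₁ ∈ 𝒜) {y : F} (hy : A.map ψ = conjBy y A₁)
    (hℰ : Carries ℰ 𝒜) (hψℰ : Carries 𝒜 (mapSystem ψ ℰ)) : ∃ x, conjBy x A ∈ ℰ := by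
  obtain ⟨E, hE, x, hAE⟩ := hℰ A hA
  obtain ⟨A₂, hA₂, z, hEA₂⟩ := hψℰ _ ⟨E, hE, rfl⟩
  have hle : A.map ψ ≤ (conjBy x E).map ψ := Subgroup.map_mono hAE
  have hle' : (conjBy x E).map ψ ≤ conjBy (ψ x * z) A₂ := by
    rw [map_conjBy, ← conjBy_conjBy]
    exact conjBy_mono _ hEA₂
  have heq : conjBy y A₁ = conjBy (ψ x * z) A₂ :=
    (h𝒜.eq_of_conjBy_le_conjBy (i := ⟨A₁, hA₁⟩) (j := ⟨A₂, hA₂⟩) (h𝒜_bot A₁ hA₁)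
      (hy ▸ hle.trans hle')).2
  have hAE_eq : A = conjBy x E :=
    Subgroup.map_injective hψ (le_antisymm hle (hle'.trans_eq (heq.symm.trans hy.symm)))
  exact ⟨x⁻¹, by rwa [hAE_eq, conjBy_inv_conjBy]⟩

theorem IsEventuallyCarried.exists_conjBy_mem (h : IsEventuallyCarried φ 𝒜 ℰ)
    (hφ : Function.Injective φ) (hfix : IsFixed φ 𝒜) (h𝒜 : IsNontrivialFreeFactorSystem 𝒜)
    {A : Subgroup F} (hA : A ∈ 𝒜) : ∃ x, conjBy x A ∈ ℰ := by
  obtain ⟨-, -, h𝒜_bot, h𝒜_family⟩ := isNontrivialFreeFactorSystem_iff.1 h𝒜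
  obtain ⟨k, hk⟩ := h.eventually
  obtain ⟨ψ, hψ, hψ_mapSystem, hψ_map⟩ := exists_hom_mapSystem_eq_iterate hφ k
  obtain ⟨A₁, hA₁, y, hy⟩ := hfix.exists_iterate_map_eq k hA
  exact exists_conjBy_mem_of_carries hψ h𝒜_family h𝒜_bot hA hA₁ ((hψ_map A).trans hy) h.carries
    (hψ_mapSystem ▸ hk)

theorem IsNontrivialFreeFactorSystem.exists_isConjugateReplacement
    (h𝒜 : IsNontrivialFreeFactorSystem 𝒜) (hℰ : IsFreeFactorSystem ℰ)
    (hconj : ∀ A ∈ 𝒜, ∃ x, conjBy x A ∈ ℰ) :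
    ∃ 𝒜', IsFreeFactorSystem 𝒜' ∧ IsConjugateReplacement 𝒜 𝒜' ∧ 𝒜' ⊆ ℰ := by
  obtain ⟨h𝒜_finite, h𝒜_nonempty, h𝒜_bot, h𝒜_family⟩ := isNontrivialFreeFactorSystem_iff.1 h𝒜
  choose x hx using fun A : 𝒜 => hconj A A.2
  let f (A : 𝒜) : Subgroup F := conjBy (x A) A
  have hf_injective : Function.Injective f := fun A A' h =>
    (h𝒜_family.eq_of_conjBy_le_conjBy (h𝒜_bot A A.2) (le_of_eq h)).1
  have hf_ne_bot (A : 𝒜) : f A ≠ ⊥ := conjBy_eq_bot_iff.not.2 (h𝒜_bot A A.2)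
  have hf_range : Set.range f ⊆ ℰ := Set.range_subset_iff.2 hx
  have := h𝒜_finite.to_subtype
  have := h𝒜_nonempty.to_subtype
  have hℰ_family : IsFreeFactorFamily fun E : ℰ => (E : Subgroup F) := by
    rcases hℰ with rfl | hℰ
    · exact absurd (hx (Classical.arbitrary 𝒜)) (hf_ne_bot _)
    · exact (isNontrivialFreeFactorSystem_iff.1 hℰ).2.2.2
  refine ⟨Set.range f, Or.inr (isNontrivialFreeFactorSystem_iff.2 ⟨Set.finite_range f,
    Set.range_nonempty f, Set.forall_mem_range.2 hf_ne_bot, hℰ_family.coe_of_subset_range ?_⟩),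
    ⟨Equiv.ofInjective f hf_injective, fun A => ⟨x A, rfl⟩⟩, hf_range⟩
  rwa [Subtype.range_coe]

theorem IsEventuallyCarried.exists_isConjugateReplacement (h : IsEventuallyCarried φ 𝒜 ℰ)
    (hφ : Function.Injective φ) (hfix : IsFixed φ 𝒜) (h𝒜 : IsFreeFactorSystem 𝒜) :
    ∃ 𝒜', IsFreeFactorSystem 𝒜' ∧ IsConjugateReplacement 𝒜 𝒜' ∧ 𝒜' ⊆ ℰ := by
  rcases h𝒜 with rfl | h𝒜
  · refine ⟨{⊥}, Or.inl rfl, ⟨Equiv.refl _, fun A => ⟨1, (conjBy_one _).symm⟩⟩, ?_⟩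
    rw [h.eq_singleton_bot hφ]
  · exact h𝒜.exists_isConjugateReplacement h.system fun A hA =>
      h.exists_conjBy_mem hφ hfix h𝒜 hA

end Elliptic

end FreeFactor

theorem mainTheorem6_general {F : Type*} [Group F] [IsFreeGroup F] [Group.FG F] (φ : F →* F)
    (hφ : Function.Injective φ) (𝒜 : Set (Subgroup F)) (h𝒜 : IsFreeFactorSystem 𝒜)
    (hfix : IsFixed φ 𝒜) :
    (∃ ℰ : Set (Subgroup F), IsElliptic φ 𝒜 ℰ ∧
      (∀ ℬ : Set (Subgroup F), IsEventuallyCarried φ 𝒜 ℬ → Carries ℰ ℬ) ∧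
      (∀ ℬ : Set (Subgroup F), IsElliptic φ 𝒜 ℬ → SystemEquiv ℬ ℰ)) ∧
    (∀ ℰ : Set (Subgroup F), IsElliptic φ 𝒜 ℰ →
      ∃ 𝒜' : Set (Subgroup F), IsFreeFactorSystem 𝒜' ∧ IsConjugateReplacement 𝒜 𝒜' ∧
        𝒜' ⊆ ℰ) := by
  obtain ⟨ℰ, hℰ, hgreatest⟩ := hfix.isInvariant.exists_greatest_isEventuallyCarried hφ h𝒜
  refine ⟨⟨ℰ, ⟨hℰ, fun ℬ hℬ _ => hgreatest ℬ hℬ⟩, hgreatest, fun ℬ hℬ => ?_⟩,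
    fun ℬ hℬ => hℬ.eventuallyCarried.exists_isConjugateReplacement hφ hfix h𝒜⟩
  have hcarries := hgreatest ℬ hℬ.eventuallyCarried
  exact ⟨hℬ.maximal ℰ hℰ hcarries, hcarries⟩

theorem mainTheorem6 {F : Type*} [Group F] {n : ℕ} (hn : 2 ≤ n) (b : FreeGroupBasis (Fin n) F)
    (φ : F →* F) (hφ : Function.Injective φ)
    (𝒜 : Set (Subgroup F)) (h𝒜 : IsMaximalFixed φ 𝒜) :
    (∃ ℰ : Set (Subgroup F), IsElliptic φ 𝒜 ℰ ∧
      (∀ ℬ : Set (Subgroup F), IsEventuallyCarried φ 𝒜 ℬ → Carries ℰ ℬ) ∧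
      (∀ ℬ : Set (Subgroup F), IsElliptic φ 𝒜 ℬ → SystemEquiv ℬ ℰ)) ∧
    (∀ ℰ : Set (Subgroup F), IsElliptic φ 𝒜 ℰ →
      ∃ 𝒜' : Set (Subgroup F), IsFreeFactorSystem 𝒜' ∧ IsConjugateReplacement 𝒜 𝒜' ∧
        𝒜' ⊆ ℰ) := by
  have := b.isFreeGroup
  have : Group.FG F := Group.fg_of_surjective (f := b.repr.symm.toMonoidHom) b.repr.symm.surjective
  exact mainTheorem6_general φ hφ 𝒜 h𝒜.system h𝒜.fixed
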